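/- **Model.** A secondary user (SU) sits at the origin of the plane $\mathbb R^2$. Power beacons at random points $X_0,X_1,\dots$ form a homogeneous Poisson point process of density $\lambda_p>0$ on the region $\{x:\|x\|\ge d_0\}$, $d_0>0$ (only beacons outside the open protection disc of radius $d_0$ are used). Beacon $p$, at distance $d_p=\|X_p\|$, has $M\ge 1$ antennas and channel vector $\mathbf h_p\in\mathbb C^M$; the entries of all channel vectors are i.i.d. circularly symmetric complex Gaussian with mean $0$ and variance $1$, and are independent of the beacon positions. The path loss is $L(d)=A d^{-\xi}$ with $A>0$, $\xi\ge 2$. Let $$G=\max_{p:\ d_p\ge d_0}\|\mathbf h_p\|^2 L(d_p).$$ A frame has length $T>0$ and is divided into fractions $\alpha_1>0$ (harvesting), $\beta>0$ (sensing), $\alpha_2\ge 0$ (harvesting) and $1-\alpha_1-\beta-\alpha_2>0$ (transmission). With conversion efficiency $\eta>0$ and beacon power $P_p>0$, the energies harvested in the first and third slots are $E_{H_1}=G\eta P_p\alpha_1T$ and $E_{H_2}=G\eta P_p\alpha_2T$. With thresholds $P_s,P_t>0$, the available sensing power and transmission power are $$P_{H_1}=\frac{E_{H_1}}{\beta T},\qquad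 P_{T_2}=\frac{(E_{H_1}-P_s\beta T)+E_{H_2}}{(1-\alpha_1-\beta-\alpha_2)T},$$ and the outage probabilities are $P_s^{out}=\Pr\{P_{H_1}\le P_s\}$ and $P_t^{out}=\Pr\{P_{T_2}\le P_t\}$. **Theorem.** Almost surely the maximum $G$ is attained, and for $\zeta\in\{s,t\}$ $$P_\zeta^{out}=\exp\left[-\frac{\pi\lambda_p\delta}{\mu_\zeta^{\delta}}\sum_{m=0}^{M-1}\frac{\Gamma(m+\delta,\ \mu_\zeta d_0^{\xi})}{m!}\right],$$ where $\delta=2/\xi$, $\Gamma(a,x)=\int_x^\infty t^{a-1}e^{-t}\,dt$ is the upper incomplete Gamma function, and $$\mu_s=\frac{\beta P_s}{\eta P_pA\alpha_1},\qquad \mu_t=\frac{P_t(1-\alpha_1-\beta-\alpha_2)+P_s\beta}{\eta P_pA(\alpha_1+\alpha_2)}.$$ -/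

import Mathlib

open MeasureTheory ProbabilityTheory Set

noncomputable section

/-- The upper incomplete Gamma function `Γ(s, x) = ∫_x^∞ t^(s-1) e^(-t) dt`. -/
def upperIncompleteGamma (s x : ℝ) : ℝ :=
  ∫ t in Ioi x, t ^ (s - 1) * Real.exp (-t)

/-- The circularly symmetric complex Gaussian law with mean `0` and variance `1`: real and imaginary
parts are independent real Gaussians of mean `0` and variance `1/2`. -/
def stdComplexGaussian : Measure ℂ :=
  ((gaussianReal 0 (1 / 2)).prod (gaussianReal 0 (1 / 2))).map
    (fun z : ℝ × ℝ => (⟨z.1, z.2⟩ : ℂ))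

section

variable {Ω : Type*} [MeasurableSpace Ω]

/-- The number of points of the random sequence `X` that lie in `B`. -/
def pointCount (X : ℕ → Ω → EuclideanSpace ℝ (Fin 2)) (B : Set (EuclideanSpace ℝ (Fin 2)))
    (ω : Ω) : ℕ∞ :=
  {n : ℕ | X n ω ∈ B}.encard

/-- The random points `X 0, X 1, …` form, inside the region `D` of the plane, a homogeneous Poisson
point process of density `lam`: the number of points in a Borel set `B ⊆ D` of finite area is Poisson
with mean `lam * area B`, and the numbers of points in disjoint such sets are independent.
Nothing is required of points outside `D`, so a homogeneous Poisson process on the whole plane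
qualifies, as does one with no point outside `D`. -/
structure IsHomogeneousPoissonOn (P : Measure Ω) (D : Set (EuclideanSpace ℝ (Fin 2))) (lam : ℝ)
    (X : ℕ → Ω → EuclideanSpace ℝ (Fin 2)) : Prop where
  measurable : ∀ n, Measurable (X n)
  poisson : ∀ B : Set (EuclideanSpace ℝ (Fin 2)), MeasurableSet B → B ⊆ D → volume B ≠ ⊤ →
    ∀ k : ℕ, P {ω | pointCount X B ω = k} =
      poissonMeasure (ENNReal.ofReal lam * volume B).toNNReal {k}
  indep : ∀ (m : ℕ) (B : Fin m → Set (EuclideanSpace ℝ (Fin 2))),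
    (∀ i, MeasurableSet (B i)) → (∀ i, B i ⊆ D) → (∀ i, volume (B i) ≠ ⊤) →
    Pairwise (fun i j => Disjoint (B i) (B j)) →
    iIndepFun (fun i => pointCount X (B i)) P

/-- The Rayleigh fading channel vectors `h 0, h 1, … ∈ ℂ^M`, one per beacon: all entries of all
vectors are i.i.d. standard complex Gaussian, and they are independent of the beacon positions. -/
structure IsRayleighFading (P : Measure Ω) {M : ℕ} (X : ℕ → Ω → EuclideanSpace ℝ (Fin 2))
    (h : ℕ → Ω → EuclideanSpace ℂ (Fin M)) : Prop where
  measurable : ∀ n, Measurable (h n)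
  law : ∀ n i, P.map (fun ω => h n ω i) = stdComplexGaussian
  indep : iIndepFun (fun (q : ℕ × Fin M) ω => h q.1 ω q.2) P
  indep_position : IndepFun (fun ω n => X n ω) (fun ω n => h n ω) P

/-- The channel gains `‖h_p‖² L(d_p)`, `L(d) = A d^(-ξ)`, of all beacons at distance at least `d₀`
from the secondary user at the origin. -/
def channelGains {M : ℕ} (X : ℕ → Ω → EuclideanSpace ℝ (Fin 2))
    (h : ℕ → Ω → EuclideanSpace ℂ (Fin M)) (d₀ A ξ : ℝ) (ω : Ω) : Set ℝ :=
  {g | ∃ n : ℕ, d₀ ≤ ‖X n ω‖ ∧ g = ‖h n ω‖ ^ 2 * (A * ‖X n ω‖ ^ (-ξ))}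

/-- The strongest channel gain. -/
def strongestGain {M : ℕ} (X : ℕ → Ω → EuclideanSpace ℝ (Fin 2))
    (h : ℕ → Ω → EuclideanSpace ℂ (Fin M)) (d₀ A ξ : ℝ) (ω : Ω) : ℝ :=
  sSup (channelGains X h d₀ A ξ ω)

end

/-- Energy harvested from a beacon with channel gain `G` and transmit power `Pp` during a fraction
`γ` of a frame of length `T`, with conversion efficiency `η`. -/
def harvestedEnergy (G η Pp γ T : ℝ) : ℝ := G * η * Pp * γ * T

/-- Maximum sensing power `E_{H₁} / (β T)`. -/
def sensingPower (G η Pp α₁ β T : ℝ) : ℝ := harvestedEnergy G η Pp α₁ T / (β * T)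

/-- Power available for data transmission: what remains after spending `E_S = P_s β T` on sensing,
plus the energy harvested in the third slot, over the duration of the fourth slot. -/
def transmissionPower (G η Pp α₁ β α₂ T Ps : ℝ) : ℝ :=
  ((harvestedEnergy G η Pp α₁ T - Ps * β * T) + harvestedEnergy G η Pp α₂ T) /
    ((1 - α₁ - β - α₂) * T)

/-- `μ_s`. -/
def muSensing (η Pp A α₁ β Ps : ℝ) : ℝ := β * Ps / (η * Pp * A * α₁)

/-- `μ_t`. -/
def muTransmission (η Pp A α₁ β α₂ Ps Pt : ℝ) : ℝ :=
  (Pt * (1 - α₁ - β - α₂) + Ps * β) / (η * Pp * A * (α₁ + α₂))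

/-- The closed form
`exp(-(π lam δ / μ^δ) ∑_{m=0}^{M-1} Γ(m + δ, μ d₀^ξ) / m!)` with `δ = 2 / ξ`. -/
def outageFormula (lam d₀ ξ : ℝ) (M : ℕ) (μ : ℝ) : ℝ :=
  Real.exp (-(Real.pi * lam * (2 / ξ) / μ ^ (2 / ξ)) *
    ∑ m ∈ Finset.range M, upperIncompleteGamma (m + 2 / ξ) (μ * d₀ ^ ξ) / (m.factorial : ℝ))

end

/-! ### Poisson counts and the intensity measure -/

section PoissonProcess

open scoped ENNReal NNReal Topology
open Filter

variable {Ω : Type*} [MeasurableSpace Ω]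

/-! The event `G ≤ g` says that no marked point `(X n, ‖h n‖²)` outside the disc has gain above `g`.
Given the positions, the marks `‖h n‖²` are i.i.d., so its conditional probability is the product of
the factors `1 - f (X n)`, where `f = exceedProb` is the chance that a beacon at a given point
exceeds `g` (`measure_forall_mem_eq_lintegral_iInf_prod`). The Laplace functional of the Poisson
process (`IsHomogeneousPoissonOn.lintegral_iInf_prod`) turns the mean of this product into `exp(-lam
∫ f)`. As a sum of `M` independent rate-one exponentials, `‖h n‖²` has an Erlang tail, so with `μ =
g / A` the value `f x` is that tail at `μ ‖x‖^ξ`. Polar coordinates and the substitution `t = μ r^ξ`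
turn each of its terms into an incomplete Gamma function (`lintegral_planar_erlangTail`).

Attainment rests on the same integral: `∫ f` is finite, so by Borel–Cantelli almost surely only
finitely many gains exceed a given `g > 0`. Almost surely some gain is positive, hence the maximum
is taken over a finite nonempty set. Attainment also makes the `sSup` in `strongestGain` a genuine
supremum, so that `G ≤ g` does mean that all gains are at most `g`. Finally, both powers are
increasing affine functions of `G`, so each outage event has the form `G ≤ g` with `g / A` equal to
`μ_s` or `μ_t`. -/

lemma measurable_pointCount {X : ℕ → Ω → EuclideanSpace ℝ (Fin 2)} (hX : ∀ n, Measurable (X n))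
    {B : Set (EuclideanSpace ℝ (Fin 2))} (hB : MeasurableSet B) :
    Measurable (pointCount X B) := by
  refine measurable_encard.comp ?_
  rw [measurable_set_iff]
  intro n
  exact (hB.mem).comp (hX n)

lemma lintegral_poissonMeasure (r : ℝ≥0) (f : ℕ → ℝ≥0∞) :
    ∫⁻ k, f k ∂(poissonMeasure r) =
      ∑' k, ENNReal.ofReal (Real.exp (-r) * r ^ k / k.factorial) * f k := by
  simp [poissonMeasure, lintegral_sum_measure]

/-- The probability generating function of the Poisson law. -/
lemma lintegral_one_sub_pow_poissonMeasure (r : ℝ≥0) {c : ℝ≥0∞} (hc : c ≤ 1) :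
    ∫⁻ k, (1 - c) ^ k ∂(poissonMeasure r) = ENNReal.ofReal (Real.exp (-(r * c.toReal))) := by
  have hc' : c ≠ ⊤ := ne_top_of_le_ne_top ENNReal.one_ne_top hc
  have h1 : 1 - c = ENNReal.ofReal (1 - c.toReal) := by
    rw [ENNReal.ofReal_sub _ ENNReal.toReal_nonneg, ENNReal.ofReal_toReal hc', ENNReal.ofReal_one]
  have h2 : 0 ≤ 1 - c.toReal := by
    have := ENNReal.toReal_mono ENNReal.one_ne_top hc
    simp at this; linarith
  have h3 := ((NormedSpace.expSeries_div_hasSum_exp ((r : ℝ) * (1 - c.toReal))).mul_left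
    (Real.exp (-r)))
  rw [lintegral_poissonMeasure]
  have h4 : ∀ k : ℕ, ENNReal.ofReal (Real.exp (-r) * r ^ k / k.factorial) * (1 - c) ^ k =
      ENNReal.ofReal (Real.exp (-r) * ((r * (1 - c.toReal)) ^ k / k.factorial)) := by
    intro k
    rw [h1, ← ENNReal.ofReal_pow h2, ← ENNReal.ofReal_mul (by positivity)]
    congr 1
    rw [mul_pow]; ring
  simp_rw [h4]
  rw [← ENNReal.ofReal_tsum_of_nonneg (fun k => by positivity) h3.summable, h3.tsum_eq,
    ← Real.exp_eq_exp_ℝ, ← Real.exp_add]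
  congr 2; ring

/-- The mean of the Poisson law. -/
lemma lintegral_natCast_poissonMeasure (r : ℝ≥0) :
    ∫⁻ k, (k : ℝ≥0∞) ∂(poissonMeasure r) = r := by
  rw [lintegral_poissonMeasure, tsum_eq_zero_add' ENNReal.summable]
  -- With `p` the Poisson weights, `(k + 1) p_{k+1} = r p_k`, so the mean is `r` times the total
  -- mass.
  have h4 : ∀ k : ℕ, ENNReal.ofReal (Real.exp (-r) * r ^ (k + 1) / (k + 1).factorial) *
      ((k + 1 : ℕ) : ℝ≥0∞) = r * ENNReal.ofReal (Real.exp (-r) * r ^ k / k.factorial) := by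
    intro k
    rw [← ENNReal.ofReal_natCast (k + 1), ← ENNReal.ofReal_mul (by positivity),
      ← ENNReal.ofReal_coe_nnreal, ← ENNReal.ofReal_mul (by positivity)]
    congr 1
    rw [Nat.factorial_succ, Nat.cast_mul]
    have : ((k + 1 : ℕ) : ℝ) ≠ 0 := by positivity
    field_simp
    ring
  simp_rw [h4]
  rw [ENNReal.tsum_mul_left, ← ENNReal.ofReal_tsum_of_nonneg (fun k => by positivity)
    (hasSum_one_poissonMeasure r).summable, (hasSum_one_poissonMeasure r).tsum_eq]
  simp

variable {P : Measure Ω} [IsProbabilityMeasure P] {D : Set (EuclideanSpace ℝ (Fin 2))} {lam : ℝ}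
  {X : ℕ → Ω → EuclideanSpace ℝ (Fin 2)}

/-- The hypothesis prescribes only the masses at finite counts. These already sum to one, which
forces the mass at `⊤` to be zero. -/
lemma IsHomogeneousPoissonOn.map_pointCount (hX : IsHomogeneousPoissonOn P D lam X)
    {B : Set (EuclideanSpace ℝ (Fin 2))} (hB : MeasurableSet B) (hBD : B ⊆ D)
    (hfin : volume B ≠ ⊤) :
    P.map (pointCount X B) =
      (poissonMeasure (ENNReal.ofReal lam * volume B).toNNReal).map (Nat.cast : ℕ → ℕ∞) := by
  have hm := measurable_pointCount hX.measurable hB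
  have : IsProbabilityMeasure (P.map (pointCount X B)) :=
    Measure.isProbabilityMeasure_map hm.aemeasurable
  set r := (ENNReal.ofReal lam * volume B).toNNReal
  have hnat : ∀ k : ℕ, P.map (pointCount X B) {(k : ℕ∞)} =
      (poissonMeasure r).map (Nat.cast : ℕ → ℕ∞) {(k : ℕ∞)} := by
    intro k
    rw [Measure.map_apply hm (measurableSet_singleton _),
      Measure.map_apply .of_discrete (measurableSet_singleton _)]
    have h1 : (Nat.cast : ℕ → ℕ∞) ⁻¹' {(k : ℕ∞)} = {k} := by ext; simp
    rw [h1]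
    exact hX.poisson B hB hBD hfin k
  have hcompl : ({(⊤ : ℕ∞)} : Set ℕ∞)ᶜ = ⋃ k : ℕ, {(k : ℕ∞)} := by
    ext x
    simp only [mem_compl_iff, mem_singleton_iff, mem_iUnion]
    constructor
    · intro h; exact ⟨x.toNat, (ENat.natCast_toNat h).symm⟩
    · rintro ⟨k, rfl⟩; exact ENat.natCast_ne_top k
  have htop : P.map (pointCount X B) {(⊤ : ℕ∞)} =
      (poissonMeasure r).map (Nat.cast : ℕ → ℕ∞) {(⊤ : ℕ∞)} := by
    have h1 : ∀ μ : Measure ℕ∞, IsProbabilityMeasure μ → μ {⊤} = 1 - ∑' k : ℕ, μ {(k : ℕ∞)} := by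
      intro μ _
      rw [← compl_compl {(⊤ : ℕ∞)}, prob_compl_eq_one_sub .of_discrete, hcompl, measure_iUnion]
      · intro i j hij; simpa using hij
      · intro i; exact .of_discrete
    rw [h1 _ this, h1 _ inferInstance]
    simp_rw [hnat]
  refine Measure.ext_of_singleton fun x => ?_
  induction x using ENat.recTopCoe with
  | top => exact htop
  | coe k => exact hnat k

lemma IsHomogeneousPoissonOn.lintegral_pointCount (hX : IsHomogeneousPoissonOn P D lam X)
    {B : Set (EuclideanSpace ℝ (Fin 2))} (hB : MeasurableSet B) (hBD : B ⊆ D)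
    (hfin : volume B ≠ ⊤) (g : ℕ∞ → ℝ≥0∞) :
    ∫⁻ ω, g (pointCount X B ω) ∂P =
      ∫⁻ k : ℕ, g k ∂(poissonMeasure (ENNReal.ofReal lam * volume B).toNNReal) := by
  rw [← lintegral_map (μ := P) (f := g) .of_discrete (measurable_pointCount hX.measurable hB),
    hX.map_pointCount hB hBD hfin, lintegral_map .of_discrete .of_discrete]

lemma IsHomogeneousPoissonOn.ae_pointCount_ne_top (hX : IsHomogeneousPoissonOn P D lam X)
    {B : Set (EuclideanSpace ℝ (Fin 2))} (hB : MeasurableSet B) (hBD : B ⊆ D)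
    (hfin : volume B ≠ ⊤) : ∀ᵐ ω ∂P, pointCount X B ω ≠ ⊤ := by
  have h : ∀ᵐ k ∂(P.map (pointCount X B)), k ≠ ⊤ := by
    rw [hX.map_pointCount hB hBD hfin, ae_map_iff .of_discrete .of_discrete]
    exact Eventually.of_forall fun k => ENat.natCast_ne_top k
  exact ae_of_ae_map (measurable_pointCount hX.measurable hB).aemeasurable h

/-- The intensity measure of the process is `lam` times the area. -/
lemma IsHomogeneousPoissonOn.sum_map_restrict (hX : IsHomogeneousPoissonOn P D lam X)
    (hD : MeasurableSet D) :
    (Measure.sum fun n => P.map (X n)).restrict D =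
      ENNReal.ofReal lam • volume.restrict D := by
  have key : ∀ B, MeasurableSet B → B ⊆ D → volume B ≠ ⊤ →
      (Measure.sum fun n => P.map (X n)) B = ENNReal.ofReal lam * volume B := by
    intro B hB hBD hfin
    -- A count is a sum of indicators, so its expectation is the sum of the laws of the points
    -- evaluated at `B`.
    have h1 : ∀ ω, ∑' n, B.indicator (fun _ => (1 : ℝ≥0∞)) (X n ω) = (pointCount X B ω : ℝ≥0∞) := by
      intro ω
      rw [pointCount, ← ENNReal.tsum_set_one, tsum_subtype {n | X n ω ∈ B} fun _ => 1]
      rfl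
    rw [Measure.sum_apply _ hB]
    calc ∑' n, P.map (X n) B = ∑' n, ∫⁻ ω, B.indicator (fun _ => (1 : ℝ≥0∞)) (X n ω) ∂P := by
          refine tsum_congr fun n => ?_
          rw [← lintegral_map (measurable_const.indicator hB) (hX.measurable n),
            lintegral_indicator_const hB, one_mul]
      _ = ∫⁻ ω, (pointCount X B ω : ℝ≥0∞) ∂P := by
          simp_rw [← h1]
          exact (lintegral_tsum fun n =>
            ((measurable_const.indicator hB).comp (hX.measurable n)).aemeasurable).symm
      _ = ENNReal.ofReal lam * volume B := by
          rw [hX.lintegral_pointCount hB hBD hfin (fun k => (k : ℝ≥0∞))]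
          simp only [ENat.toENNReal_coe]
          rw [lintegral_natCast_poissonMeasure, ENNReal.coe_toNNReal]
          exact ENNReal.mul_ne_top ENNReal.ofReal_ne_top hfin
  -- `key` needs finite area; σ-finiteness of the area measure removes this restriction.
  rw [Measure.ext_iff_of_iUnion_eq_univ
    (iUnion_spanningSets (volume : Measure (EuclideanSpace ℝ (Fin 2))))]
  intro i
  ext s hs
  have hm := measurableSet_spanningSets (volume : Measure (EuclideanSpace ℝ (Fin 2))) i
  rw [Measure.restrict_apply hs, Measure.restrict_apply hs, Measure.restrict_apply (hs.inter hm),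
    Measure.smul_apply, Measure.restrict_apply (hs.inter hm), smul_eq_mul]
  refine key _ ((hs.inter hm).inter hD) inter_subset_right (ne_of_lt ?_)
  exact (measure_mono (inter_subset_left.trans inter_subset_right)).trans_lt
    (measure_spanningSets_lt_top _ i)

end PoissonProcess

/-! ### The Laplace functional, for simple functions and then by monotone limits -/

section LaplaceFunctional

open scoped ENNReal NNReal Topology
open Filter

/-- Factors at most 1 make the partial products decrease, so the infimum serves as the infinite
product; it stabilises once the range contains `F`. -/
lemma iInf_prod_range_eq_prod {u : ℕ → ℝ≥0∞} (hu : ∀ n, u n ≤ 1) (F : Finset ℕ)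
    (hF : ∀ n, n ∉ F → u n = 1) :
    ⨅ N, ∏ n ∈ Finset.range N, u n = ∏ n ∈ F, u n := by
  apply le_antisymm
  · obtain ⟨N, hN⟩ := F.exists_nat_subset_range
    refine iInf_le_of_le N (le_of_eq ?_)
    exact (Finset.prod_subset hN fun n _ hn => hF n hn).symm
  · refine le_iInf fun N => ?_
    calc ∏ n ∈ F, u n ≤ ∏ n ∈ F ∩ Finset.range N, u n :=
          Finset.prod_le_prod_of_subset_of_le_one' Finset.inter_subset_left fun n _ _ => hu n
      _ = ∏ n ∈ Finset.range N, u n :=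
          Finset.prod_subset Finset.inter_subset_right fun n hn hn' => hF n fun h =>
            hn' (Finset.mem_inter.2 ⟨h, hn⟩)

/-- Points are grouped by the value of `φ`, and each level set contributes a power whose exponent is
its count. The value 0 gives factors 1 and may occur infinitely often. -/
lemma iInf_prod_one_sub_eq {E : Type*} [MeasurableSpace E] (φ : SimpleFunc E ℝ≥0∞) (x : ℕ → E)
    (hfin : ∀ c ∈ φ.range.filter (· ≠ 0), {n | x n ∈ φ ⁻¹' {c}}.Finite) :
    ⨅ N, ∏ n ∈ Finset.range N, (1 - φ (x n)) =
      ∏ c ∈ φ.range.filter (· ≠ 0), (1 - c) ^ {n | x n ∈ φ ⁻¹' {c}}.encard.toNat := by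
  classical
  have hT : {n | φ (x n) ≠ 0}.Finite := by
    refine ((φ.range.filter (· ≠ 0)).finite_toSet.biUnion hfin).subset fun n hn => ?_
    simp only [mem_iUnion]
    exact ⟨φ (x n), Finset.mem_filter.2 ⟨φ.mem_range_self _, hn⟩, rfl⟩
  rw [iInf_prod_range_eq_prod (fun n => tsub_le_self) hT.toFinset fun n hn => by
    have : φ (x n) = 0 := by simpa using hn
    simp [this]]
  rw [← Finset.prod_fiberwise_of_maps_to (g := fun n => φ (x n))
    (t := φ.range.filter (· ≠ 0)) fun n hn => Finset.mem_filter.2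
      ⟨φ.mem_range_self _, by simpa using hn⟩]
  refine Finset.prod_congr rfl fun c hc => ?_
  have hc0 : c ≠ 0 := (Finset.mem_filter.1 hc).2
  rw [Finset.prod_congr rfl (g := fun _ => 1 - c) fun n hn => by rw [(Finset.mem_filter.1 hn).2],
    Finset.prod_const]
  congr 1
  have : {n | x n ∈ φ ⁻¹' {c}} = ((hT.toFinset.filter fun n => φ (x n) = c : Finset ℕ) : Set ℕ) := by
    ext n
    simp only [mem_preimage, mem_singleton_iff, mem_ofPred_eq, Finset.coe_filter,
      Finite.mem_toFinset]
    exact ⟨fun h => ⟨h ▸ hc0, h⟩, fun h => h.2⟩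
  rw [this, encard_coe_eq_coe_finsetCard]
  simp

variable {Ω : Type*} [MeasurableSpace Ω] {P : Measure Ω} [IsProbabilityMeasure P]
  {D : Set (EuclideanSpace ℝ (Fin 2))} {lam : ℝ} {X : ℕ → Ω → EuclideanSpace ℝ (Fin 2)}

/-- Level sets of `φ` are disjoint, so their counts are independent Poisson variables. The
expectation factors into probability generating functions, whose exponents add up to the integral of
`φ`. -/
lemma IsHomogeneousPoissonOn.lintegral_iInf_prod_simpleFunc
    (hX : IsHomogeneousPoissonOn P D lam X) (hlam : 0 ≤ lam)
    (φ : SimpleFunc (EuclideanSpace ℝ (Fin 2)) ℝ≥0∞) (hφ : ∀ x, φ x ≤ 1)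
    (hφD : ∀ x, x ∉ D → φ x = 0) (hfin : ∫⁻ x, φ x ≠ ⊤) :
    ∫⁻ ω, ⨅ N, ∏ n ∈ Finset.range N, (1 - φ (X n ω)) ∂P =
      ENNReal.ofReal (Real.exp (-(lam * (∫⁻ x, φ x).toReal))) := by
  classical
  set s := φ.range.filter (· ≠ 0)
  have hs : ∀ c ∈ s, c ≠ 0 ∧ c ≤ 1 := by
    intro c hc
    refine ⟨(Finset.mem_filter.1 hc).2, ?_⟩
    obtain ⟨x, rfl⟩ := SimpleFunc.mem_range.1 (Finset.mem_filter.1 hc).1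
    exact hφ x
  have hm : ∀ c, MeasurableSet (φ ⁻¹' {c}) := fun c => φ.measurableSet_preimage _
  have hBD : ∀ c ∈ s, φ ⁻¹' {c} ⊆ D := by
    intro c hc x hx
    by_contra h
    exact (hs c hc).1 (by rw [← hφD x h]; exact hx.symm)
  have hint : ∫⁻ x, φ x = φ.lintegral volume := φ.lintegral_eq_lintegral volume
  rw [hint] at hfin ⊢
  -- A finite integral forces every level set of a nonzero value to have finite area, as the Poisson
  -- hypotheses demand.
  have hvol : ∀ c ∈ s, volume (φ ⁻¹' {c}) ≠ ⊤ := fun c hc =>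
    ((SimpleFunc.FinMeasSupp.of_lintegral_ne_top hfin).meas_preimage_singleton_ne_zero
      (hs c hc).1).ne
  have hae : ∀ᵐ ω ∂P, ∀ c ∈ s, pointCount X (φ ⁻¹' {c}) ω ≠ ⊤ :=
    (Finset.eventually_all s).2 fun c hc =>
      hX.ae_pointCount_ne_top (hm c) (hBD c hc) (hvol c hc)
  have h1 : ∀ᵐ ω ∂P, ⨅ N, ∏ n ∈ Finset.range N, (1 - φ (X n ω)) =
      ∏ c : s, (1 - c.1) ^ (pointCount X (φ ⁻¹' {c.1}) ω).toNat := by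
    filter_upwards [hae] with ω hω
    rw [iInf_prod_one_sub_eq φ (fun n => X n ω) fun c hc => encard_ne_top_iff.1 (hω c hc),
      ← Finset.prod_coe_sort]
    rfl
  have hind : iIndepFun (fun c : s => pointCount X (φ ⁻¹' {c.1})) P := by
    have h2 := hX.indep (Fintype.card s) (fun i => φ ⁻¹' {((Fintype.equivFin s).symm i).1})
      (fun i => hm _) (fun i => hBD _ ((Fintype.equivFin s).symm i).2)
      (fun i => hvol _ ((Fintype.equivFin s).symm i).2) (fun i j hij => by
        refine Disjoint.preimage _ (disjoint_singleton.2 fun h => hij ?_)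
        exact (Fintype.equivFin s).symm.injective (Subtype.ext h))
    have h3 := h2.precomp (Fintype.equivFin s).injective
    simpa only [Function.comp_def, Equiv.symm_apply_apply] using h3
  rw [lintegral_congr_ae h1]
  have h4 := lintegral_prod_eq_prod_lintegral_of_indepFun Finset.univ
    (fun (c : s) ω => (1 - c.1) ^ (pointCount X (φ ⁻¹' {c.1}) ω).toNat)
    (hind.comp (fun c k => (1 - c.1) ^ k.toNat) fun c => .of_discrete)
    (fun c => Measurable.comp (g := fun k : ℕ∞ => (1 - c.1) ^ k.toNat) .of_discrete
      (measurable_pointCount hX.measurable (hm c)))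
  rw [h4]
  have h5 : ∀ c : s, ∫⁻ ω, (1 - c.1) ^ (pointCount X (φ ⁻¹' {c.1}) ω).toNat ∂P =
      ENNReal.ofReal (Real.exp (-(lam * (c.1 * volume (φ ⁻¹' {c.1})).toReal))) := by
    intro c
    rw [hX.lintegral_pointCount (hm c) (hBD c c.2) (hvol c c.2)
      (fun k => (1 - c.1) ^ k.toNat)]
    simp only [ENat.toNat_natCast]
    rw [lintegral_one_sub_pow_poissonMeasure _ (hs c c.2).2]
    congr 3
    rw [ENNReal.coe_toNNReal_eq_toReal, ENNReal.toReal_mul, ENNReal.toReal_mul,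
      ENNReal.toReal_ofReal hlam]
    ring
  simp_rw [h5]
  rw [← ENNReal.ofReal_prod_of_nonneg fun c _ => (Real.exp_pos _).le, ← Real.exp_sum,
    Finset.sum_neg_distrib, ← Finset.mul_sum, SimpleFunc.lintegral, ← ENNReal.toReal_sum
      fun (c : s) _ => ENNReal.mul_ne_top (ne_top_of_le_ne_top ENNReal.one_ne_top (hs c c.2).2)
        (hvol c c.2)]
  rw [Finset.sum_coe_sort s fun c => c * volume (φ ⁻¹' {c}), Finset.sum_filter_of_ne]
  intro c _ h h'
  simp [h'] at h

/-- The Laplace functional of a Poisson process. -/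
theorem IsHomogeneousPoissonOn.lintegral_iInf_prod
    (hX : IsHomogeneousPoissonOn P D lam X) (hlam : 0 ≤ lam)
    {f : EuclideanSpace ℝ (Fin 2) → ℝ≥0∞} (hfm : Measurable f) (hf : ∀ x, f x ≤ 1)
    (hfD : ∀ x, x ∉ D → f x = 0) (hfin : ∫⁻ x, f x ≠ ⊤) :
    ∫⁻ ω, ⨅ N, ∏ n ∈ Finset.range N, (1 - f (X n ω)) ∂P =
      ENNReal.ofReal (Real.exp (-(lam * (∫⁻ x, f x).toReal))) := by
  set φ := SimpleFunc.eapprox f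
  have hmono : Monotone φ := SimpleFunc.monotone_eapprox f
  have hle : ∀ k x, φ k x ≤ f x := fun k x => by
    rw [← SimpleFunc.iSup_eapprox_apply hfm x]
    exact le_iSup (fun k => SimpleFunc.eapprox f k x) k
  have hprodlim : ∀ ω N, ⨅ k, ∏ n ∈ Finset.range N, (1 - φ k (X n ω)) =
      ∏ n ∈ Finset.range N, (1 - f (X n ω)) := by
    intro ω N
    refine iInf_eq_of_tendsto (fun k l hkl => Finset.prod_le_prod' fun n _ =>
      tsub_le_tsub_left (hmono hkl _) _) ?_
    refine ENNReal.tendsto_finsetProd_of_ne_top _ (fun n _ => ?_) fun n _ =>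
      ne_top_of_le_ne_top ENNReal.one_ne_top tsub_le_self
    refine ENNReal.Tendsto.sub tendsto_const_nhds ?_ (Or.inl ENNReal.one_ne_top)
    rw [← SimpleFunc.iSup_eapprox_apply hfm (X n ω)]
    exact tendsto_atTop_iSup fun k l hkl => hmono hkl _
  -- The products decrease in both `N` and `k`, so the limit in `k` is an infimum and the two infima
  -- commute.
  have h1 : ∀ ω, ⨅ N, ∏ n ∈ Finset.range N, (1 - f (X n ω)) =
      ⨅ k, ⨅ N, ∏ n ∈ Finset.range N, (1 - φ k (X n ω)) := by
    intro ω
    rw [iInf_comm]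
    simp_rw [hprodlim]
  simp_rw [h1]
  rw [lintegral_iInf]
  · have hfink : ∀ k, ∫⁻ x, φ k x ≠ ⊤ := fun k =>
      ne_top_of_le_ne_top hfin (lintegral_mono (hle k))
    have h2 : ∀ k, ∫⁻ ω, ⨅ N, ∏ n ∈ Finset.range N, (1 - φ k (X n ω)) ∂P =
        ENNReal.ofReal (Real.exp (-(lam * (∫⁻ x, φ k x).toReal))) := fun k =>
      hX.lintegral_iInf_prod_simpleFunc hlam (φ k) (fun x => (hle k x).trans (hf x))
        (fun x hx => le_antisymm ((hle k x).trans_eq (hfD x hx)) zero_le) (hfink k)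
    simp_rw [h2]
    have h3 : Tendsto (fun k => ∫⁻ x, φ k x) atTop (𝓝 (∫⁻ x, f x)) :=
      lintegral_tendsto_of_tendsto_of_monotone (fun k => (φ k).measurable.aemeasurable)
        (Eventually.of_forall fun x k l hkl => hmono hkl x)
        (Eventually.of_forall fun x => by
          rw [← SimpleFunc.iSup_eapprox_apply hfm x]
          exact tendsto_atTop_iSup fun k l hkl => hmono hkl _)
    refine iInf_eq_of_tendsto (fun k l hkl => ?_) ?_
    · refine ENNReal.ofReal_le_ofReal (Real.exp_le_exp.2 (neg_le_neg
        (mul_le_mul_of_nonneg_left ?_ hlam)))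
      exact ENNReal.toReal_mono (hfink l) (lintegral_mono (hmono hkl))
    · refine ENNReal.tendsto_ofReal ((Real.continuous_exp.tendsto _).comp ?_)
      exact (((ENNReal.tendsto_toReal hfin).comp h3).const_mul lam).neg
  · intro k
    refine Measurable.iInf fun N => Finset.measurable_fun_prod _ fun n _ => ?_
    exact measurable_const.sub ((φ k).measurable.comp (hX.measurable n))
  · intro k l hkl ω
    refine iInf_mono fun N => Finset.prod_le_prod' fun n _ => ?_
    exact tsub_le_tsub_left (hmono hkl _) _
  -- Decreasing monotone convergence needs a finite integral to start from; the empty product at `N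
  -- = 0` bounds the integrand by 1.
  · refine ne_top_of_le_ne_top ENNReal.one_ne_top ?_
    refine (lintegral_mono (g := fun _ => 1) fun ω => iInf_le_of_le 0 (by simp)).trans ?_
    simp

end LaplaceFunctional

/-! ### Independent marking -/

section IndependentMarks

open scoped ENNReal NNReal Topology
open Filter

/-- The law of an i.i.d. marking: if the marks `Y n` are i.i.d. and independent of the points
`X n`, the probability that all marked points lie in `S`, given the points, is the product of the
probabilities of the sections of `S`. -/
theorem measure_forall_mem_eq_lintegral_iInf_prod {Ω E F : Type*} [MeasurableSpace Ω]
    [MeasurableSpace E] [MeasurableSpace F] {P : Measure Ω} [IsProbabilityMeasure P]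
    {X : ℕ → Ω → E} {Y : ℕ → Ω → F} (hX : ∀ n, Measurable (X n)) (hY : ∀ n, Measurable (Y n))
    (hXY : IndepFun (fun ω n => X n ω) (fun ω n => Y n ω) P) (hYi : iIndepFun Y P)
    {Q : Measure F} (hQ : ∀ n, P.map (Y n) = Q) {S : Set (E × F)} (hS : MeasurableSet S) :
    P {ω | ∀ n, (X n ω, Y n ω) ∈ S} =
      ∫⁻ ω, ⨅ N, ∏ n ∈ Finset.range N, Q (Prod.mk (X n ω) ⁻¹' S) ∂P := by
  have hXm : Measurable fun ω n => X n ω := measurable_pi_iff.2 hX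
  have hYm : Measurable fun ω n => Y n ω := measurable_pi_iff.2 hY
  have hQp : IsProbabilityMeasure Q := hQ 0 ▸ Measure.isProbabilityMeasure_map (hY 0).aemeasurable
  have hlaw : P.map (fun ω n => Y n ω) = Measure.infinitePi fun _ => Q := by
    rw [hYi.map_fun_eq_infinitePi_map hY]
    simp_rw [hQ]
  set A : Set ((ℕ → E) × (ℕ → F)) := {p | ∀ n, (p.1 n, p.2 n) ∈ S}
  have hA : MeasurableSet A := by
    have : A = ⋂ n, (fun p : (ℕ → E) × (ℕ → F) => (p.1 n, p.2 n)) ⁻¹' S := by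
      ext p; simp [A]
    rw [this]
    exact MeasurableSet.iInter fun n => hS.preimage (by fun_prop)
  have hsec : ∀ x : ℕ → E, (Measure.infinitePi fun _ : ℕ => Q) (Prod.mk x ⁻¹' A) =
      ⨅ N, ∏ n ∈ Finset.range N, Q (Prod.mk (x n) ⁻¹' S) := by
    intro x
    have hm : ∀ n, MeasurableSet (Prod.mk (x n) ⁻¹' S) := fun n => measurable_prodMk_left hS
    -- The section is a decreasing intersection of finite cylinders, so continuity from above
    -- applies.
    have h1 : Prod.mk x ⁻¹' A =
        ⋂ N, Set.pi (Finset.range N : Set ℕ) fun n => Prod.mk (x n) ⁻¹' S := by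
      ext y
      simp only [A, mem_preimage, mem_iInter, Set.mem_pi, Finset.coe_range, mem_Iio]
      exact ⟨fun h N n _ => h n, fun h n => h (n + 1) n (Nat.lt_succ_self n)⟩
    rw [h1, Antitone.measure_iInter]
    · refine iInf_congr fun N => ?_
      exact Measure.infinitePi_pi _ fun n _ => hm n
    · intro k l hkl y hy n hn
      exact hy n (Finset.range_mono hkl hn)
    · intro N
      exact (MeasurableSet.pi (Finset.countable_toSet _) fun n _ => hm n).nullMeasurableSet
    · exact ⟨0, measure_ne_top _ _⟩
  have h2 : P {ω | ∀ n, (X n ω, Y n ω) ∈ S} =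
      P.map (fun ω => ((fun n => X n ω), fun n => Y n ω)) A := by
    rw [Measure.map_apply (hXm.prodMk hYm) hA]
    rfl
  rw [h2, (indepFun_iff_map_prod_eq_prod_map_map hXm.aemeasurable hYm.aemeasurable).1 hXY, hlaw,
    Measure.prod_apply hA]
  simp_rw [hsec]
  rw [lintegral_map _ hXm]
  refine Measurable.iInf fun N => Finset.measurable_fun_prod _ fun n _ => ?_
  exact (measurable_measure_prodMk_left hS).comp (measurable_pi_apply n)

end IndependentMarks

noncomputable section

/-! ### From complex Gaussian entries to the Erlang tail -/

section RayleighGain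

open scoped ENNReal NNReal Topology
open Filter

lemma lintegral_Ioi_ofReal_exp_neg (t : ℝ) :
    ∫⁻ y in Ioi t, ENNReal.ofReal (Real.exp (-y)) = ENNReal.ofReal (Real.exp (-t)) := by
  rw [← ofReal_integral_eq_lintegral_ofReal (integrableOn_exp_neg_Ioi t)
    (Eventually.of_forall fun y => (Real.exp_pos _).le), integral_exp_neg_Ioi]

lemma lintegral_Ioi_two_mul_exp_neg_sq {a : ℝ} (ha : 0 ≤ a) :
    ∫⁻ r in Ioi a, ENNReal.ofReal (2 * r * Real.exp (-r ^ 2)) =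
      ENNReal.ofReal (Real.exp (-a ^ 2)) := by
  have hd : ∀ x ∈ Ici a, HasDerivAt (fun r : ℝ => -Real.exp (-r ^ 2))
      (2 * x * Real.exp (-x ^ 2)) x := by
    intro x _
    have h := ((hasDerivAt_pow 2 x).neg.exp).neg
    convert! h using 1
    simp
    ring
  have hpos : ∀ x ∈ Ioi a, 0 ≤ 2 * x * Real.exp (-x ^ 2) := fun x hx => by
    have : 0 ≤ x := ha.trans (le_of_lt hx)
    positivity
  have hlim : Tendsto (fun r : ℝ => -Real.exp (-r ^ 2)) atTop (𝓝 0) := by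
    rw [← neg_zero]
    exact (Real.tendsto_exp_neg_atTop_nhds_zero.comp (tendsto_pow_atTop two_ne_zero)).neg
  rw [← ofReal_integral_eq_lintegral_ofReal (integrableOn_Ioi_deriv_of_nonneg' hd hpos hlim)
    ((ae_restrict_iff' measurableSet_Ioi).2 (Eventually.of_forall hpos)),
    integral_Ioi_of_hasDerivAt_of_nonneg' hd hpos hlim]
  simp

lemma gaussianReal_prod_apply_norm_sq_gt {t : ℝ} (ht : 0 ≤ t) :
    ((gaussianReal 0 (1 / 2)).prod (gaussianReal 0 (1 / 2))) {p : ℝ × ℝ | t < p.1 ^ 2 + p.2 ^ 2} =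
      ENNReal.ofReal (Real.exp (-t)) := by
  have hS : MeasurableSet {p : ℝ × ℝ | t < p.1 ^ 2 + p.2 ^ 2} :=
    measurableSet_lt measurable_const (by fun_prop)
  rw [gaussianReal_of_var_ne_zero _ (by norm_num), prod_withDensity (by fun_prop) (by fun_prop),
    withDensity_apply _ hS, ← lintegral_indicator hS, ← Measure.volume_eq_prod,
    ← lintegral_comp_polarCoord_symm]
  -- Variance `1/2` gives the joint density `exp(-r²) / π`. With the Jacobian `r` it splits into the
  -- radial density `2 r exp(-r²)` and the uniform angular density `1 / (2π)`.
  have h1 : ∀ p ∈ polarCoord.target, ENNReal.ofReal p.1 •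
      ({p : ℝ × ℝ | t < p.1 ^ 2 + p.2 ^ 2}.indicator
        (fun z => gaussianPDF 0 (1 / 2) z.1 * gaussianPDF 0 (1 / 2) z.2) (polarCoord.symm p)) =
      (Ioi √t).indicator (fun r => ENNReal.ofReal (2 * r * Real.exp (-r ^ 2))) p.1 *
        ENNReal.ofReal (2 * Real.pi)⁻¹ := by
    rintro ⟨r, θ⟩ hp
    have hr : 0 < r := hp.1
    have h2 : (r * Real.cos θ) ^ 2 + (r * Real.sin θ) ^ 2 = r ^ 2 := by
      have := Real.sin_sq_add_cos_sq θ
      linear_combination r ^ 2 * this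
    have h3 : (t < r ^ 2) ↔ √t < r := (Real.sqrt_lt' hr).symm
    simp only [indicator, polarCoord_symm_apply, mem_ofPred_eq, mem_Ioi, h2, h3]
    split_ifs
    · simp only [gaussianPDF, gaussianPDFReal, smul_eq_mul]
      rw [← ENNReal.ofReal_mul (by positivity), ← ENNReal.ofReal_mul hr.le,
        ← ENNReal.ofReal_mul (by positivity)]
      congr 1
      have h4 : ((1 / 2 : ℝ≥0) : ℝ) = 1 / 2 := by norm_num
      rw [h4]
      have h5 : (2 * Real.pi * (1 / 2 : ℝ)) = Real.pi := by ring
      rw [h5]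
      have h6 : √Real.pi ^ 2 = Real.pi := Real.sq_sqrt Real.pi_pos.le
      have h7 : Real.exp (-(r * Real.cos θ - 0) ^ 2 / (2 * (1 / 2))) *
          Real.exp (-(r * Real.sin θ - 0) ^ 2 / (2 * (1 / 2))) = Real.exp (-r ^ 2) := by
        rw [← Real.exp_add]
        congr 1
        rw [← h2]; ring
      calc _ = r * ((√Real.pi ^ 2)⁻¹ * (Real.exp (-(r * Real.cos θ - 0) ^ 2 / (2 * (1 / 2))) *
          Real.exp (-(r * Real.sin θ - 0) ^ 2 / (2 * (1 / 2))))) := by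
            rw [sq (√Real.pi), mul_inv]; ring
        _ = _ := by rw [h6, h7, mul_inv]; ring
    · simp
  rw [setLIntegral_congr_fun polarCoord.open_target.measurableSet h1, polarCoord_target,
    Measure.volume_eq_prod, ← Measure.prod_restrict,
    lintegral_prod_mul ((Measurable.indicator (by fun_prop) measurableSet_Ioi).aemeasurable)
      aemeasurable_const,
    setLIntegral_indicator measurableSet_Ioi,
    inter_eq_left.2 (Ioi_subset_Ioi (Real.sqrt_nonneg t)),
    lintegral_Ioi_two_mul_exp_neg_sq (Real.sqrt_nonneg t), Real.sq_sqrt ht, setLIntegral_const,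
    Real.volume_Ioo, ← ENNReal.ofReal_mul (by positivity), ← ENNReal.ofReal_mul (by positivity)]
  congr 1
  field_simp
  ring

lemma stdComplexGaussian_norm_sq_gt {t : ℝ} (ht : 0 ≤ t) :
    stdComplexGaussian {z | t < ‖z‖ ^ 2} = ENNReal.ofReal (Real.exp (-t)) := by
  have hm : Measurable fun z : ℝ × ℝ => (⟨z.1, z.2⟩ : ℂ) :=
    Complex.measurableEquivRealProd.symm.measurable
  rw [stdComplexGaussian, Measure.map_apply hm (measurableSet_lt measurable_const (by fun_prop)),
    ← gaussianReal_prod_apply_norm_sq_gt ht]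
  congr 1
  ext p
  simp only [mem_preimage, mem_ofPred_eq, Complex.sq_norm, Complex.normSq_apply, ← sq]

lemma isProbabilityMeasure_stdComplexGaussian : IsProbabilityMeasure stdComplexGaussian :=
  Measure.isProbabilityMeasure_map
    Complex.measurableEquivRealProd.symm.measurable.aemeasurable

/-- The squared modulus of a standard complex Gaussian is exponential of rate one. -/
lemma map_norm_sq_stdComplexGaussian :
    stdComplexGaussian.map (fun z => ‖z‖ ^ 2) = expMeasure 1 := by
  have := isProbabilityMeasure_stdComplexGaussian
  have hm : Measurable fun z : ℂ => ‖z‖ ^ 2 := by fun_prop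
  have : IsProbabilityMeasure (stdComplexGaussian.map (fun z => ‖z‖ ^ 2)) :=
    Measure.isProbabilityMeasure_map hm.aemeasurable
  have := isProbabilityMeasure_expMeasure one_pos
  refine Measure.eq_of_cdf _ _ ?_
  ext x
  rw [cdf_expMeasure_eq one_pos, cdf_eq_real]
  split_ifs with hx
  · rw [← compl_Ioi, probReal_compl_eq_one_sub measurableSet_Ioi, measureReal_def,
      Measure.map_apply hm measurableSet_Ioi]
    have : (fun z : ℂ => ‖z‖ ^ 2) ⁻¹' Ioi x = {z | x < ‖z‖ ^ 2} := rfl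
    rw [this, stdComplexGaussian_norm_sq_gt hx, ENNReal.toReal_ofReal (Real.exp_pos _).le, one_mul]
  · rw [measureReal_def, Measure.map_apply hm measurableSet_Iic]
    have : (fun z : ℂ => ‖z‖ ^ 2) ⁻¹' Iic x = ∅ := by
      ext z
      simp only [mem_preimage, mem_Iic, mem_empty_iff_false, iff_false, not_le]
      exact (not_le.1 hx).trans_le (by positivity)
    simp [this]

/-- The tail of the Erlang law with shape `n` and rate one. -/
def erlangTail (n : ℕ) (t : ℝ) : ℝ :=
  Real.exp (-t) * ∑ m ∈ Finset.range n, t ^ m / (m.factorial : ℝ)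

lemma erlangTail_nonneg (n : ℕ) {t : ℝ} (ht : 0 ≤ t) : 0 ≤ erlangTail n t := by
  unfold erlangTail; positivity

/-- Integrating `(t - y)^m / m!` over `[0, t]` gives `t^(m+1) / (m+1)!`, so the convolution shifts
the Erlang sum by one index; `exp(-t)` restores the term `m = 0`. -/
lemma integral_erlangTail_succ (n : ℕ) (t : ℝ) :
    (∫ y in (0 : ℝ)..t, Real.exp (-y) * erlangTail n (t - y)) + Real.exp (-t) =
      erlangTail (n + 1) t := by
  have h1 : ∀ y, Real.exp (-y) * erlangTail n (t - y) =
      Real.exp (-t) * ∑ m ∈ Finset.range n, (t - y) ^ m / (m.factorial : ℝ) := by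
    intro y
    rw [erlangTail, ← mul_assoc, ← Real.exp_add]
    congr 2; ring
  simp_rw [h1]
  rw [intervalIntegral.integral_const_mul, intervalIntegral.integral_finsetSum fun m _ =>
    Continuous.intervalIntegrable (by fun_prop) _ _]
  have h2 : ∀ m : ℕ, ∫ y in (0 : ℝ)..t, (t - y) ^ m / (m.factorial : ℝ) =
      t ^ (m + 1) / ((m + 1).factorial : ℝ) := by
    intro m
    rw [intervalIntegral.integral_div, intervalIntegral.integral_comp_sub_left (fun y => y ^ m),
      integral_pow, Nat.factorial_succ]
    push_cast
    rw [sub_self, sub_zero, zero_pow (Nat.succ_ne_zero m), sub_zero, div_div]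
  simp_rw [h2]
  rw [erlangTail, Finset.sum_range_succ']
  simp [mul_add]

lemma measure_add_exponential_gt {Ω : Type*} [MeasurableSpace Ω] {P : Measure Ω}
    [IsProbabilityMeasure P] {X Y : Ω → ℝ} (hX : Measurable X) (hY : Measurable Y)
    (hXY : IndepFun X Y P) (hlaw : P.map Y = expMeasure 1) (t : ℝ) :
    P {ω | t < X ω + Y ω} =
      ∫⁻ y in Ioi 0, ENNReal.ofReal (Real.exp (-y)) * P {ω | t - y < X ω} := by
  have : IsProbabilityMeasure (P.map X) := Measure.isProbabilityMeasure_map hX.aemeasurable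
  have : IsProbabilityMeasure (P.map Y) := Measure.isProbabilityMeasure_map hY.aemeasurable
  have hS : MeasurableSet {p : ℝ × ℝ | t < p.1 + p.2} :=
    measurableSet_lt measurable_const (by fun_prop)
  have h1 : P {ω | t < X ω + Y ω} = ((P.map X).prod (P.map Y)) {p : ℝ × ℝ | t < p.1 + p.2} := by
    rw [← (indepFun_iff_map_prod_eq_prod_map_map hX.aemeasurable hY.aemeasurable).1 hXY,
      Measure.map_apply (by fun_prop) hS]
    rfl
  have h2 : ∀ y, P.map X ((fun x => (x, y)) ⁻¹' {p : ℝ × ℝ | t < p.1 + p.2}) =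
      P {ω | t - y < X ω} := by
    intro y
    rw [Measure.map_apply hX (measurable_prodMk_right hS)]
    congr 1
    ext ω
    simp [sub_lt_iff_lt_add]
  have hm : Measurable fun y => P {ω | t - y < X ω} := by
    simp_rw [← h2]
    exact measurable_measure_prodMk_right hS
  rw [h1, Measure.prod_apply_symm hS, hlaw]
  simp_rw [h2]
  have hg : Measurable (gammaPDF 1 1) := (measurable_gammaPDFReal 1 1).ennreal_ofReal
  rw [expMeasure, gammaMeasure, lintegral_withDensity_eq_lintegral_mul _ hg hm,
    ← lintegral_indicator measurableSet_Ioi]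
  refine lintegral_congr_ae ?_
  filter_upwards [Measure.ae_ne volume (0 : ℝ)] with y hy
  rw [Pi.mul_apply]
  rcases lt_or_gt_of_ne hy with h | h
  · rw [gammaPDF_of_neg h, zero_mul, indicator_of_notMem]
    exact fun h' => lt_asymm h h'
  · rw [indicator_of_mem (mem_Ioi.2 h), gammaPDF_of_nonneg h.le]
    simp

/-- Condition on `Y = y` and split at `y = t`: beyond `t` the event is certain because `X ≥ 0`,
which yields the extra `exp(-t)`. -/
lemma measure_add_exponential_gt_eq_erlangTail {Ω : Type*} [MeasurableSpace Ω] {P : Measure Ω}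
    [IsProbabilityMeasure P] {X Y : Ω → ℝ} (hX : Measurable X) (hY : Measurable Y)
    (hXY : IndepFun X Y P) (hlaw : P.map Y = expMeasure 1) (hX0 : ∀ ω, 0 ≤ X ω) {n : ℕ}
    (hn : ∀ t, 0 ≤ t → P {ω | t < X ω} = ENNReal.ofReal (erlangTail n t)) {t : ℝ} (ht : 0 ≤ t) :
    P {ω | t < X ω + Y ω} = ENNReal.ofReal (erlangTail (n + 1) t) := by
  have hcont : Continuous fun y => Real.exp (-y) * erlangTail n (t - y) := by
    unfold erlangTail; fun_prop
  rw [measure_add_exponential_gt hX hY hXY hlaw, ← Ioc_union_Ioi_eq_Ioi ht,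
    lintegral_union measurableSet_Ioi (Ioc_disjoint_Ioi le_rfl)]
  have h1 : ∫⁻ y in Ioc 0 t, ENNReal.ofReal (Real.exp (-y)) * P {ω | t - y < X ω} =
      ENNReal.ofReal (∫ y in (0 : ℝ)..t, Real.exp (-y) * erlangTail n (t - y)) := by
    rw [intervalIntegral.integral_of_le ht, ofReal_integral_eq_lintegral_ofReal
      (hcont.integrableOn_Ioc) ((ae_restrict_iff' measurableSet_Ioc).2
        (Eventually.of_forall fun y hy => mul_nonneg (Real.exp_pos _).le
          (erlangTail_nonneg n (sub_nonneg.2 hy.2))))]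
    refine setLIntegral_congr_fun measurableSet_Ioc fun y hy => ?_
    rw [hn _ (sub_nonneg.2 hy.2), ENNReal.ofReal_mul (Real.exp_pos _).le]
  have h2 : ∫⁻ y in Ioi t, ENNReal.ofReal (Real.exp (-y)) * P {ω | t - y < X ω} =
      ENNReal.ofReal (Real.exp (-t)) := by
    rw [← lintegral_Ioi_ofReal_exp_neg]
    refine setLIntegral_congr_fun measurableSet_Ioi fun y hy => ?_
    have : {ω | t - y < X ω} = univ := by
      ext ω
      simp only [mem_ofPred_eq, mem_univ, iff_true]
      have := hX0 ω
      have := mem_Ioi.1 hy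
      linarith
    simp [this]
  rw [h1, h2, ← ENNReal.ofReal_add _ (Real.exp_pos _).le, integral_erlangTail_succ]
  rw [intervalIntegral.integral_of_le ht]
  exact setIntegral_nonneg measurableSet_Ioc fun y hy => mul_nonneg (Real.exp_pos _).le
    (erlangTail_nonneg n (sub_nonneg.2 hy.2))

lemma measure_sum_exponential_gt {Ω ι : Type*} [MeasurableSpace Ω] {P : Measure Ω}
    [IsProbabilityMeasure P] {Y : ι → Ω → ℝ} (hY : ∀ i, Measurable (Y i)) (hY0 : ∀ i ω, 0 ≤ Y i ω)
    (hind : iIndepFun Y P) (hlaw : ∀ i, P.map (Y i) = expMeasure 1) (s : Finset ι) {t : ℝ}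
    (ht : 0 ≤ t) :
    P {ω | t < ∑ i ∈ s, Y i ω} = ENNReal.ofReal (erlangTail s.card t) := by
  classical
  induction s using Finset.induction_on generalizing t with
  | empty => simp [erlangTail, not_lt.2 ht]
  | insert i s hi ih =>
    have h := hind.indepFun_finsetSum_of_notMem hY hi
    have hsum : (∑ j ∈ s, Y j) = fun ω => ∑ j ∈ s, Y j ω := by ext; simp
    rw [hsum] at h
    rw [Finset.card_insert_of_notMem hi,
      ← measure_add_exponential_gt_eq_erlangTail (Finset.measurable_fun_sum s fun j _ => hY j)
        (hY i) h (hlaw i) (fun ω => Finset.sum_nonneg fun j _ => hY0 j ω) (fun t ht => ih ht) ht]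
    simp_rw [Finset.sum_insert hi, add_comm (Y i _)]

variable {Ω : Type*} [MeasurableSpace Ω] {P : Measure Ω} {M : ℕ}
  {X : ℕ → Ω → EuclideanSpace ℝ (Fin 2)} {h : ℕ → Ω → EuclideanSpace ℂ (Fin M)}

lemma IsRayleighFading.measurable_entry (hh : IsRayleighFading P X h) (n : ℕ) (i : Fin M) :
    Measurable fun ω => h n ω i :=
  ((EuclideanSpace.proj i : EuclideanSpace ℂ (Fin M) →L[ℂ] ℂ).continuous.measurable).comp
    (hh.measurable n)

/-- The squared norm of a Rayleigh fading channel vector has the Erlang law. -/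
lemma IsRayleighFading.measure_norm_sq_gt [IsProbabilityMeasure P] (hh : IsRayleighFading P X h) (n : ℕ) {t : ℝ}
    (ht : 0 ≤ t) : P {ω | t < ‖h n ω‖ ^ 2} = ENNReal.ofReal (erlangTail M t) := by
  have h1 := measure_sum_exponential_gt (P := P) (Y := fun (i : Fin M) ω => ‖h n ω i‖ ^ 2)
    (fun i => (hh.measurable_entry n i).norm.pow_const 2) (fun i ω => by positivity)
    ((hh.indep.precomp (Prod.mk_right_injective n)).comp (fun _ z => ‖z‖ ^ 2)
      fun _ => by fun_prop)
    (fun i => by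
      rw [← map_norm_sq_stdComplexGaussian, ← hh.law n i,
        Measure.map_map (by fun_prop) (hh.measurable_entry n i)]
      rfl) Finset.univ ht
  simpa [EuclideanSpace.norm_sq_eq] using h1

/-- Independence is assumed entry by entry; currying the product measure over `ℕ × Fin M` regroups
the entries into independent rows. -/
lemma IsRayleighFading.iIndepFun_norm_sq [IsProbabilityMeasure P] (hh : IsRayleighFading P X h) :
    iIndepFun (fun n ω => ‖h n ω‖ ^ 2) P := by
  have hm := hh.measurable_entry
  have hp : ∀ (n : ℕ) (i : Fin M), IsProbabilityMeasure (P.map fun ω => h n ω i) := fun n i =>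
    Measure.isProbabilityMeasure_map (hm n i).aemeasurable
  have hrow : iIndepFun (fun n ω (i : Fin M) => h n ω i) P := by
    rw [iIndepFun_iff_map_fun_eq_infinitePi_map fun n => measurable_pi_iff.2 (hm n)]
    have h1 : ∀ n, P.map (fun ω (i : Fin M) => h n ω i) =
        Measure.infinitePi fun i => P.map fun ω => h n ω i := fun n =>
      (hh.indep.precomp (Prod.mk_right_injective n)).map_fun_eq_infinitePi_map (hm n)
    simp_rw [h1]
    rw [← Measure.infinitePi_map_curry (fun n (i : Fin M) => P.map fun ω => h n ω i),
      ← hh.indep.map_fun_eq_infinitePi_map fun q : ℕ × Fin M => hm q.1 q.2, Measure.map_map (by fun_prop)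
        (measurable_pi_iff.2 fun q : ℕ × Fin M => hm q.1 q.2)]
    rfl
  have := hrow.comp (fun _ z => ∑ i, ‖z i‖ ^ 2) fun _ => by fun_prop
  simpa [EuclideanSpace.norm_sq_eq, Function.comp_def] using this

end RayleighGain

end

noncomputable section

/-! ### The planar integral of the Erlang tail -/

section PlanarIntegral

open scoped ENNReal NNReal Topology
open Filter

lemma integrableOn_rpow_mul_erlangTail (M : ℕ) {δ : ℝ} (hδ : 0 < δ) :
    IntegrableOn (fun t => t ^ (δ - 1) * erlangTail M t) (Ioi 0) := by
  have h1 : ∀ t ∈ Ioi (0 : ℝ), ∑ m ∈ Finset.range M,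
      (Real.exp (-t) * t ^ ((m + δ) - 1)) / (m.factorial : ℝ) = t ^ (δ - 1) * erlangTail M t := by
    intro t ht
    rw [erlangTail, Finset.mul_sum, Finset.mul_sum]
    refine Finset.sum_congr rfl fun m _ => ?_
    rw [add_sub_assoc, Real.rpow_add ht, Real.rpow_natCast]
    ring
  refine IntegrableOn.congr_fun ?_ h1 measurableSet_Ioi
  refine integrable_finsetSum _ fun m _ => Integrable.div_const ?_ _
  exact Real.GammaIntegral_convergent (by positivity)

lemma integral_rpow_mul_erlangTail (M : ℕ) {δ : ℝ} (hδ : 0 < δ) {a : ℝ} (ha : 0 ≤ a) :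
    ∫ t in Ioi a, t ^ (δ - 1) * erlangTail M t =
      ∑ m ∈ Finset.range M, upperIncompleteGamma (m + δ) a / (m.factorial : ℝ) := by
  have h1 : ∀ t ∈ Ioi a, t ^ (δ - 1) * erlangTail M t = ∑ m ∈ Finset.range M,
      (t ^ ((m + δ) - 1) * Real.exp (-t)) / (m.factorial : ℝ) := by
    intro t ht
    rw [erlangTail, Finset.mul_sum, Finset.mul_sum]
    refine Finset.sum_congr rfl fun m _ => ?_
    rw [add_sub_assoc, Real.rpow_add (ha.trans_lt ht), Real.rpow_natCast]
    ring
  rw [setIntegral_congr_fun measurableSet_Ioi h1, integral_finsetSum]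
  · simp_rw [integral_div, upperIncompleteGamma]
  · intro m _
    refine Integrable.div_const ?_ _
    have := (Real.GammaIntegral_convergent (s := m + δ) (by positivity)).mono_set
      (Ioi_subset_Ioi ha)
    simpa only [IntegrableOn, mul_comm] using this

variable {M : ℕ} {d₀ ξ μ : ℝ}

/-- The radial profile of the thinned intensity, as a multiple of a function of `μ * y ^ ξ`. -/
lemma mul_indicator_erlangTail (hd₀ : 0 < d₀) (hξ : 0 < ξ) (hμ : 0 < μ) {y : ℝ} (hy : 0 < y) :
    y * (Ici d₀).indicator (fun y => erlangTail M (μ * y ^ ξ)) y =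
      (ξ⁻¹ * μ ^ (1 - 2 / ξ)) * ((ξ * y ^ (ξ - 1)) •
        (fun u => (Ici (μ * d₀ ^ ξ)).indicator (fun t => t ^ (2 / ξ - 1) * erlangTail M t)
          (μ * u)) (y ^ ξ)) := by
  have h1 : y ∈ Ici d₀ ↔ μ * y ^ ξ ∈ Ici (μ * d₀ ^ ξ) := by
    rw [mem_Ici, mem_Ici, mul_le_mul_iff_right₀ hμ, Real.rpow_le_rpow_iff hd₀.le hy.le hξ]
  by_cases h : y ∈ Ici d₀
  · simp only [indicator_of_mem h, indicator_of_mem (h1.1 h), smul_eq_mul]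
    -- These identities express `y` through the derivative `ξ y^(ξ-1)` of `u = y^ξ`. The later
    -- scaling `t = μ u` costs a factor `μ⁻¹`, hence `μ^(1 - 2/ξ)` here for a final `μ^(-2/ξ)`.
    have h2 : (y ^ ξ) ^ (2 / ξ - 1) = y ^ (2 - ξ) := by
      rw [← Real.rpow_mul hy.le]
      congr 1
      field_simp
    have h3 : y ^ (ξ - 1) * y ^ (2 - ξ) = y := by
      rw [← Real.rpow_add hy]
      norm_num
    have h4 : μ ^ (1 - 2 / ξ) * μ ^ (2 / ξ - 1) = 1 := by
      rw [← Real.rpow_add hμ]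
      norm_num
    rw [Real.mul_rpow hμ.le (Real.rpow_nonneg hy.le _), h2]
    calc y * erlangTail M (μ * y ^ ξ) = (ξ⁻¹ * ξ) * (μ ^ (1 - 2 / ξ) * μ ^ (2 / ξ - 1)) *
          (y ^ (ξ - 1) * y ^ (2 - ξ)) * erlangTail M (μ * y ^ ξ) := by
            rw [h3, h4, inv_mul_cancel₀ hξ.ne']; ring
      _ = _ := by ring
  · simp only [indicator_of_notMem h, indicator_of_notMem (mt h1.2 h)]
    simp

lemma integrableOn_mul_indicator_erlangTail (hd₀ : 0 < d₀) (hξ : 0 < ξ) (hμ : 0 < μ) :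
    IntegrableOn (fun y => y * (Ici d₀).indicator (fun y => erlangTail M (μ * y ^ ξ)) y)
      (Ioi 0) := by
  refine IntegrableOn.congr_fun ?_ (fun y hy => (mul_indicator_erlangTail hd₀ hξ hμ hy).symm)
    measurableSet_Ioi
  refine Integrable.const_mul ?_ _
  have h1 : IntegrableOn ((Ici (μ * d₀ ^ ξ)).indicator
      fun t => t ^ (2 / ξ - 1) * erlangTail M t) (Ioi (μ * 0)) := by
    rw [mul_zero]
    exact (integrableOn_rpow_mul_erlangTail M (by positivity)).indicator measurableSet_Ici
  have h2 := (integrableOn_Ioi_comp_mul_left_iff _ 0 hμ).2 h1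
  have h3 := (integrableOn_Ioi_comp_rpow_iff _ hξ.ne').2 h2
  rwa [abs_of_pos hξ] at h3

lemma integral_mul_indicator_erlangTail (hd₀ : 0 < d₀) (hξ : 0 < ξ) (hμ : 0 < μ) :
    ∫ y in Ioi 0, y * (Ici d₀).indicator (fun y => erlangTail M (μ * y ^ ξ)) y =
      (ξ⁻¹ / μ ^ (2 / ξ)) * ∑ m ∈ Finset.range M,
        upperIncompleteGamma (m + 2 / ξ) (μ * d₀ ^ ξ) / (m.factorial : ℝ) := by
  have ha : 0 < μ * d₀ ^ ξ := by positivity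
  rw [setIntegral_congr_fun measurableSet_Ioi
    (fun y hy => mul_indicator_erlangTail hd₀ hξ hμ hy), integral_const_mul]
  have h1 := integral_comp_rpow_Ioi (fun u => (Ici (μ * d₀ ^ ξ)).indicator
    (fun t => t ^ (2 / ξ - 1) * erlangTail M t) (μ * u)) hξ.ne'
  rw [abs_of_pos hξ] at h1
  rw [h1, integral_comp_mul_left_Ioi _ 0 hμ, mul_zero, setIntegral_indicator measurableSet_Ici,
    inter_eq_right.2 (Ici_subset_Ioi.2 ha), integral_Ici_eq_integral_Ioi,
    integral_rpow_mul_erlangTail M (by positivity) ha.le, smul_eq_mul, ← mul_assoc]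
  congr 1
  rw [Real.rpow_sub hμ, Real.rpow_one]
  field_simp

lemma measurable_erlangTail (M : ℕ) : Measurable (erlangTail M) := by
  unfold erlangTail
  fun_prop

/-- The area integral of the probability that a beacon exceeds a given gain. -/
lemma lintegral_planar_erlangTail (hd₀ : 0 < d₀) (hξ : 0 < ξ) (hμ : 0 < μ) :
    ∫⁻ x : EuclideanSpace ℝ (Fin 2), {x | d₀ ≤ ‖x‖}.indicator
        (fun x => ENNReal.ofReal (erlangTail M (μ * ‖x‖ ^ ξ))) x =
      ENNReal.ofReal ((Real.pi * (2 / ξ) / μ ^ (2 / ξ)) * ∑ m ∈ Finset.range M,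
        upperIncompleteGamma (m + 2 / ξ) (μ * d₀ ^ ξ) / (m.factorial : ℝ)) := by
  set F : ℝ → ℝ := (Ici d₀).indicator fun y => erlangTail M (μ * y ^ ξ)
  have hF0 : ∀ x : EuclideanSpace ℝ (Fin 2), 0 ≤ F ‖x‖ := fun x =>
    indicator_nonneg (fun y (hy : d₀ ≤ y) => erlangTail_nonneg M
      (mul_nonneg hμ.le (Real.rpow_nonneg (hd₀.le.trans hy) _))) _
  have h1 : ∀ x : EuclideanSpace ℝ (Fin 2), {x | d₀ ≤ ‖x‖}.indicator
      (fun x => ENNReal.ofReal (erlangTail M (μ * ‖x‖ ^ ξ))) x = ENNReal.ofReal (F ‖x‖) := by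
    intro x
    by_cases h : d₀ ≤ ‖x‖ <;> simp [F, indicator, h]
  have hint : Integrable (fun x : EuclideanSpace ℝ (Fin 2) => F ‖x‖) := by
    rw [integrable_fun_norm_addHaar]
    simpa using integrableOn_mul_indicator_erlangTail (M := M) hd₀ hξ hμ
  simp_rw [h1]
  rw [← ofReal_integral_eq_lintegral_ofReal hint (Eventually.of_forall hF0),
    integral_fun_norm_addHaar]
  -- The radial formula carries the constant dimension times unit-ball volume, here `2π`.
  have h2 : (volume : Measure (EuclideanSpace ℝ (Fin 2))).real (Metric.ball 0 1) = Real.pi := by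
    rw [measureReal_def, EuclideanSpace.volume_ball_fin_two]
    simp [Real.pi_pos.le]
  have h3 := integral_mul_indicator_erlangTail (M := M) hd₀ hξ hμ
  simp only [finrank_euclideanSpace, Fintype.card_fin, Nat.add_one_sub_one, pow_one, smul_eq_mul,
    h2, nsmul_eq_mul, F] at h3 ⊢
  rw [h3]
  congr 1
  push_cast
  ring

end PlanarIntegral

end

noncomputable section

/-! ### Attainment and distribution of the strongest gain -/

section StrongestGain

open scoped ENNReal NNReal Topology
open Filter

/-- The marked points whose gain is at most `g`. -/
def gainLE (d₀ A ξ g : ℝ) : Set (EuclideanSpace ℝ (Fin 2) × ℝ) :=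
  {p | d₀ ≤ ‖p.1‖ → p.2 * (A * ‖p.1‖ ^ (-ξ)) ≤ g}

lemma measurableSet_gainLE (d₀ A ξ g : ℝ) : MeasurableSet (gainLE d₀ A ξ g) := by
  have h1 : gainLE d₀ A ξ g = {p | d₀ ≤ ‖p.1‖}ᶜ ∪ {p | p.2 * (A * ‖p.1‖ ^ (-ξ)) ≤ g} := by
    ext p
    simp only [gainLE, mem_ofPred_eq, mem_union, mem_compl_iff]
    tauto
  rw [h1]
  exact (measurableSet_le measurable_const (by fun_prop)).compl.union
    (measurableSet_le (by fun_prop) measurable_const)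

lemma forall_channelGains_le_iff {Ω : Type*} {M : ℕ} {X : ℕ → Ω → EuclideanSpace ℝ (Fin 2)}
    {h : ℕ → Ω → EuclideanSpace ℂ (Fin M)} {d₀ A ξ g : ℝ} {ω : Ω} :
    (∀ r ∈ channelGains X h d₀ A ξ ω, r ≤ g) ↔
      ∀ n, (X n ω, ‖h n ω‖ ^ 2) ∈ gainLE d₀ A ξ g := by
  constructor
  · exact fun H n hn => H _ ⟨n, hn, rfl⟩
  · rintro H _ ⟨n, hn, rfl⟩
    exact H n hn

variable {Ω : Type*} [MeasurableSpace Ω] {P : Measure Ω}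
  {X : ℕ → Ω → EuclideanSpace ℝ (Fin 2)} {lam d₀ : ℝ}

/-- Almost surely, a Poisson process of positive density has a point outside a disc. -/
lemma IsHomogeneousPoissonOn.ae_exists_norm_ge
    (hX : IsHomogeneousPoissonOn P {x | d₀ ≤ ‖x‖} lam X) (hlam : 0 < lam) :
    ∀ᵐ ω ∂P, ∃ n, d₀ ≤ ‖X n ω‖ := by
  -- Bounded pieces exhaust a region of infinite area, so their void probabilities `exp(-lam *
  -- area)` tend to zero.
  set B : ℕ → Set (EuclideanSpace ℝ (Fin 2)) := fun k =>
    {x | d₀ ≤ ‖x‖} ∩ Metric.closedBall 0 k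
  have hD : MeasurableSet {x : EuclideanSpace ℝ (Fin 2) | d₀ ≤ ‖x‖} :=
    measurableSet_le measurable_const measurable_norm
  have hfin : ∀ k, volume (B k) ≠ ⊤ := fun k =>
    ((measure_mono inter_subset_right).trans_lt measure_closedBall_lt_top).ne
  have hmono : Monotone B := fun k l hkl => inter_subset_inter_right _
    (Metric.closedBall_subset_closedBall (by exact_mod_cast hkl))
  have hU : ⋃ k, B k = {x | d₀ ≤ ‖x‖} := by
    rw [← inter_iUnion, Metric.iUnion_closedBall_nat, inter_univ]
  have hvol : volume {x : EuclideanSpace ℝ (Fin 2) | d₀ ≤ ‖x‖} = ⊤ := by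
    have h1 : {x : EuclideanSpace ℝ (Fin 2) | d₀ ≤ ‖x‖} = (Metric.ball 0 d₀)ᶜ := by
      ext x; simp
    rw [h1, measure_compl measurableSet_ball measure_ball_lt_top.ne,
      measure_univ_of_isAddLeftInvariant, ENNReal.top_sub measure_ball_lt_top.ne]
  have hlim : Tendsto (fun k => volume (B k)) atTop (𝓝 ⊤) := by
    rw [← hvol, ← hU]
    exact tendsto_measure_iUnion_atTop hmono
  have hle : ∀ k, P {ω | ¬ ∃ n, d₀ ≤ ‖X n ω‖} ≤
      ENNReal.ofReal (Real.exp (-(lam * (volume (B k)).toReal))) := by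
    intro k
    calc P {ω | ¬ ∃ n, d₀ ≤ ‖X n ω‖} ≤ P {ω | pointCount X (B k) ω = (0 : ℕ)} := by
          refine measure_mono fun ω hω => ?_
          simp only [mem_ofPred_eq, pointCount, Nat.cast_zero, encard_eq_zero]
          ext n
          simp only [mem_ofPred_eq, mem_empty_iff_false, iff_false]
          exact fun hn => hω ⟨n, hn.1⟩
      _ = _ := by
          rw [hX.poisson _ (hD.inter measurableSet_closedBall) inter_subset_left (hfin k),
            poissonMeasure_singleton, ENNReal.coe_toNNReal_eq_toReal, ENNReal.toReal_mul,
            ENNReal.toReal_ofReal hlam.le]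
          simp [B]
  have hlim' : Tendsto (fun k => ENNReal.ofReal (Real.exp (-(lam * (volume (B k)).toReal))))
      atTop (𝓝 0) := by
    rw [← ENNReal.ofReal_zero]
    refine ENNReal.tendsto_ofReal (Real.tendsto_exp_neg_atTop_nhds_zero.comp ?_)
    refine Tendsto.const_mul_atTop hlam ?_
    rw [← ENNReal.tendsto_ofReal_nhds_top]
    simpa only [ENNReal.ofReal_toReal (hfin _)] using hlim
  exact le_antisymm (ge_of_tendsto' hlim' hle) zero_le

variable {M : ℕ} {h : ℕ → Ω → EuclideanSpace ℂ (Fin M)} {A ξ : ℝ}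

lemma IsRayleighFading.indepFun_norm_sq (hh : IsRayleighFading P X h) :
    IndepFun (fun ω n => X n ω) (fun ω n => ‖h n ω‖ ^ 2) P :=
  hh.indep_position.comp (φ := id)
    (ψ := fun (z : ℕ → EuclideanSpace ℂ (Fin M)) n => ‖z n‖ ^ 2) measurable_id (by fun_prop)

variable [IsProbabilityMeasure P]

/-- The probability that a beacon at `x` lies outside the disc and has gain exceeding `g`. -/
def exceedProb (M : ℕ) (d₀ ξ μ : ℝ) (x : EuclideanSpace ℝ (Fin 2)) : ℝ≥0∞ :=
  {x | d₀ ≤ ‖x‖}.indicator (fun x => ENNReal.ofReal (erlangTail M (μ * ‖x‖ ^ ξ))) x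

lemma measurable_exceedProb (M : ℕ) (d₀ ξ μ : ℝ) : Measurable (exceedProb M d₀ ξ μ) :=
  Measurable.indicator (((measurable_erlangTail M).comp (by fun_prop)).ennreal_ofReal)
    (measurableSet_le measurable_const measurable_norm)

lemma IsRayleighFading.map_norm_sq_eq (hh : IsRayleighFading P X h) (n : ℕ) :
    P.map (fun ω => ‖h n ω‖ ^ 2) = P.map (fun ω => ‖h 0 ω‖ ^ 2) := by
  have hm : ∀ n, Measurable fun ω => ‖h n ω‖ ^ 2 := fun n => (hh.measurable n).norm.pow_const 2
  have hp : ∀ n, IsProbabilityMeasure (P.map fun ω => ‖h n ω‖ ^ 2) := fun n =>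
    Measure.isProbabilityMeasure_map (hm n).aemeasurable
  have hIoi : ∀ n t, P.map (fun ω => ‖h n ω‖ ^ 2) (Ioi t) =
      if 0 ≤ t then ENNReal.ofReal (erlangTail M t) else 1 := by
    intro n t
    rw [Measure.map_apply (hm n) measurableSet_Ioi]
    split_ifs with ht
    · exact hh.measure_norm_sq_gt n ht
    · have : (fun ω => ‖h n ω‖ ^ 2) ⁻¹' Ioi t = univ := by
        ext ω
        simp only [mem_preimage, mem_Ioi, mem_univ, iff_true]
        exact (not_le.1 ht).trans_le (by positivity)
      rw [this, measure_univ]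
  refine Measure.ext_of_Iic _ _ fun t => ?_
  rw [← compl_Ioi, prob_compl_eq_one_sub measurableSet_Ioi,
    prob_compl_eq_one_sub measurableSet_Ioi, hIoi, hIoi]

/-- Outside the disc, exceeding `g` means `‖h‖² > (g / A) ‖x‖^ξ`, an Erlang tail event; inside, no
constraint can be violated. -/
lemma IsRayleighFading.map_norm_sq_gainLE_compl (hh : IsRayleighFading P X h) (hd₀ : 0 < d₀)
    (hA : 0 < A) {g : ℝ} (hg : 0 < g) (x : EuclideanSpace ℝ (Fin 2)) :
    P.map (fun ω => ‖h 0 ω‖ ^ 2) (Prod.mk x ⁻¹' (gainLE d₀ A ξ g)ᶜ) =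
      exceedProb M d₀ ξ (g / A) x := by
  have hm : Measurable fun ω => ‖h 0 ω‖ ^ 2 := (hh.measurable 0).norm.pow_const 2
  by_cases hx : d₀ ≤ ‖x‖
  · have hx0 : 0 < ‖x‖ := hd₀.trans_le hx
    have h1 : Prod.mk x ⁻¹' (gainLE d₀ A ξ g)ᶜ = Ioi (g / A * ‖x‖ ^ ξ) := by
      ext y
      have hpos : 0 < ‖x‖ ^ ξ := Real.rpow_pos_of_pos hx0 _
      have h2 : y * (A * ‖x‖ ^ (-ξ)) = A * y / ‖x‖ ^ ξ := by
        rw [Real.rpow_neg hx0.le]; ring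
      simp only [gainLE, mem_preimage, mem_compl_iff, mem_ofPred_eq, hx, forall_const, not_le,
        mem_Ioi, h2]
      rw [lt_div_iff₀ hpos, div_mul_eq_mul_div, div_lt_iff₀ hA, mul_comm y A]
    rw [h1, Measure.map_apply hm measurableSet_Ioi, exceedProb, indicator_of_mem (by exact hx)]
    exact hh.measure_norm_sq_gt 0 (by positivity)
  · have h1 : Prod.mk x ⁻¹' (gainLE d₀ A ξ g)ᶜ = ∅ := by
      ext y; simp [gainLE, hx]
    rw [h1, measure_empty, exceedProb, indicator_of_notMem (by exact hx)]

lemma outageFormula_eq (hA : 0 < A) {g : ℝ} (hg : 0 < g) (hd₀ : 0 < d₀) (hξ : 0 < ξ) :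
    Real.exp (-(lam * (∫⁻ x, exceedProb M d₀ ξ (g / A) x).toReal)) =
      outageFormula lam d₀ ξ M (g / A) := by
  unfold exceedProb
  rw [lintegral_planar_erlangTail hd₀ hξ (by positivity), ENNReal.toReal_ofReal, outageFormula]
  · congr 1
    ring
  · refine mul_nonneg (by positivity) (Finset.sum_nonneg fun m _ => div_nonneg ?_ (by positivity))
    refine setIntegral_nonneg measurableSet_Ioi fun t ht => ?_
    have : 0 ≤ t := (show (0 : ℝ) ≤ g / A * d₀ ^ ξ by positivity).trans (le_of_lt ht)
    positivity

lemma lintegral_exceedProb_ne_top (hA : 0 < A) {g : ℝ} (hg : 0 < g) (hd₀ : 0 < d₀) (hξ : 0 < ξ) :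
    ∫⁻ x, exceedProb M d₀ ξ (g / A) x ≠ ⊤ := by
  unfold exceedProb
  rw [lintegral_planar_erlangTail hd₀ hξ (by positivity)]
  exact ENNReal.ofReal_ne_top

/-- The probability that no beacon outside the disc has gain exceeding `g`. -/
lemma measure_forall_gainLE (hX : IsHomogeneousPoissonOn P {x | d₀ ≤ ‖x‖} lam X)
    (hh : IsRayleighFading P X h) (hlam : 0 < lam) (hd₀ : 0 < d₀) (hA : 0 < A) (hξ : 0 < ξ)
    {g : ℝ} (hg : 0 < g) :
    P {ω | ∀ n, (X n ω, ‖h n ω‖ ^ 2) ∈ gainLE d₀ A ξ g} =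
      ENNReal.ofReal (outageFormula lam d₀ ξ M (g / A)) := by
  have hm : ∀ n, Measurable fun ω => ‖h n ω‖ ^ 2 := fun n => (hh.measurable n).norm.pow_const 2
  have hp : IsProbabilityMeasure (P.map fun ω => ‖h 0 ω‖ ^ 2) :=
    Measure.isProbabilityMeasure_map (hm 0).aemeasurable
  have hS := measurableSet_gainLE d₀ A ξ g
  have h1 : ∀ x, P.map (fun ω => ‖h 0 ω‖ ^ 2) (Prod.mk x ⁻¹' gainLE d₀ A ξ g) =
      1 - exceedProb M d₀ ξ (g / A) x := by
    intro x
    rw [← hh.map_norm_sq_gainLE_compl hd₀ hA hg, preimage_compl,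
      prob_compl_eq_one_sub (measurable_prodMk_left hS),
      ENNReal.sub_sub_cancel ENNReal.one_ne_top prob_le_one]
  rw [measure_forall_mem_eq_lintegral_iInf_prod hX.measurable hm hh.indepFun_norm_sq
    hh.iIndepFun_norm_sq hh.map_norm_sq_eq hS]
  simp_rw [h1]
  rw [hX.lintegral_iInf_prod hlam.le (measurable_exceedProb M d₀ ξ (g / A)) (fun x => ?_)
    (fun x hx => indicator_of_notMem hx _) (lintegral_exceedProb_ne_top hA hg hd₀ hξ),
    outageFormula_eq hA hg hd₀ hξ]
  rw [← hh.map_norm_sq_gainLE_compl hd₀ hA hg]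
  exact prob_le_one

/-- Almost surely only finitely many beacons have gain exceeding `g`. -/
lemma ae_finite_gain_gt (hX : IsHomogeneousPoissonOn P {x | d₀ ≤ ‖x‖} lam X)
    (hh : IsRayleighFading P X h) (hd₀ : 0 < d₀) (hA : 0 < A) (hξ : 0 < ξ)
    {g : ℝ} (hg : 0 < g) :
    ∀ᵐ ω ∂P, {n | (X n ω, ‖h n ω‖ ^ 2) ∉ gainLE d₀ A ξ g}.Finite := by
  have hm : ∀ n, Measurable fun ω => ‖h n ω‖ ^ 2 := fun n => (hh.measurable n).norm.pow_const 2
  have hp : IsProbabilityMeasure (P.map fun ω => ‖h 0 ω‖ ^ 2) :=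
    Measure.isProbabilityMeasure_map (hm 0).aemeasurable
  have hS := (measurableSet_gainLE d₀ A ξ g).compl
  have hD : MeasurableSet {x : EuclideanSpace ℝ (Fin 2) | d₀ ≤ ‖x‖} :=
    measurableSet_le measurable_const measurable_norm
  have h1 : ∀ n, P {ω | (X n ω, ‖h n ω‖ ^ 2) ∉ gainLE d₀ A ξ g} =
      ∫⁻ x, exceedProb M d₀ ξ (g / A) x ∂(P.map (X n)) := by
    intro n
    have hind : IndepFun (X n) (fun ω => ‖h n ω‖ ^ 2) P :=
      hh.indepFun_norm_sq.comp (measurable_pi_apply n) (measurable_pi_apply n)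
    have h2 : P {ω | (X n ω, ‖h n ω‖ ^ 2) ∉ gainLE d₀ A ξ g} =
        P.map (fun ω => (X n ω, ‖h n ω‖ ^ 2)) (gainLE d₀ A ξ g)ᶜ := by
      rw [Measure.map_apply ((hX.measurable n).prodMk (hm n)) hS]
      rfl
    rw [h2, (indepFun_iff_map_prod_eq_prod_map_map (hX.measurable n).aemeasurable
      (hm n).aemeasurable).1 hind, hh.map_norm_sq_eq n, Measure.prod_apply hS]
    simp_rw [hh.map_norm_sq_gainLE_compl hd₀ hA hg]
  -- Borel–Cantelli: the probabilities sum to the integral of `exceedProb` against the intensity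
  -- measure.
  refine ae_finite_setOfPred_mem
    (s := fun n => {ω | (X n ω, ‖h n ω‖ ^ 2) ∉ gainLE d₀ A ξ g}) ?_
  rw [tsum_congr h1, ← lintegral_sum_measure]
  -- The intensity is known only on the region, but `exceedProb` vanishes off it.
  have h3 : ∀ ν : Measure (EuclideanSpace ℝ (Fin 2)), ∫⁻ x, exceedProb M d₀ ξ (g / A) x ∂ν =
      ∫⁻ x, exceedProb M d₀ ξ (g / A) x ∂(ν.restrict {x | d₀ ≤ ‖x‖}) := by
    intro ν
    unfold exceedProb
    rw [lintegral_indicator hD, lintegral_indicator hD, Measure.restrict_restrict hD, inter_self]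
  rw [h3, hX.sum_map_restrict hD, lintegral_smul_measure, ← h3]
  exact ENNReal.mul_ne_top ENNReal.ofReal_ne_top (lintegral_exceedProb_ne_top hA hg hd₀ hξ)

lemma IsRayleighFading.ae_norm_pos (hh : IsRayleighFading P X h) (hM : 1 ≤ M) :
    ∀ᵐ ω ∂P, ∀ n, 0 < ‖h n ω‖ ^ 2 := by
  rw [ae_all_iff]
  intro n
  have h1 : P {ω | 0 < ‖h n ω‖ ^ 2} = 1 := by
    rw [hh.measure_norm_sq_gt n le_rfl, erlangTail]
    obtain ⟨k, rfl⟩ := Nat.exists_eq_add_of_le' hM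
    simp [Finset.sum_range_succ']
  exact (mem_ae_iff_prob_eq_one
    (measurableSet_lt measurable_const ((hh.measurable n).norm.pow_const 2))).2 h1

/-- Almost surely the strongest gain is attained. -/
theorem ae_isGreatest_strongestGain (hX : IsHomogeneousPoissonOn P {x | d₀ ≤ ‖x‖} lam X)
    (hh : IsRayleighFading P X h) (hM : 1 ≤ M) (hlam : 0 < lam) (hd₀ : 0 < d₀) (hA : 0 < A)
    (hξ : 0 < ξ) :
    ∀ᵐ ω ∂P, IsGreatest (channelGains X h d₀ A ξ ω) (strongestGain X h d₀ A ξ ω) := by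
  have hfin : ∀ᵐ ω ∂P, ∀ k : ℕ,
      {n | (X n ω, ‖h n ω‖ ^ 2) ∉ gainLE d₀ A ξ (1 / ((k : ℝ) + 1))}.Finite :=
    ae_all_iff.2 fun k => ae_finite_gain_gt hX hh hd₀ hA hξ (by positivity)
  filter_upwards [hfin, hX.ae_exists_norm_ge hlam, hh.ae_norm_pos hM] with ω hω hex hpos
  obtain ⟨n₀, hn₀⟩ := hex
  have hg₀ : 0 < ‖h n₀ ω‖ ^ 2 * (A * ‖X n₀ ω‖ ^ (-ξ)) :=
    mul_pos (hpos n₀) (mul_pos hA (Real.rpow_pos_of_pos (hd₀.trans_le hn₀) _))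
  -- A threshold below one positive gain leaves a finite nonempty set of beacons; its best one also
  -- beats every gain under the threshold.
  obtain ⟨k, hk⟩ := exists_nat_one_div_lt hg₀
  obtain ⟨n, hn, hmax⟩ := (hω k).exists_maximalFor
    (fun n => ‖h n ω‖ ^ 2 * (A * ‖X n ω‖ ^ (-ξ))) _ ⟨n₀, fun H => (hk.not_ge) (H hn₀)⟩
  have hn' : d₀ ≤ ‖X n ω‖ ∧ 1 / ((k : ℝ) + 1) < ‖h n ω‖ ^ 2 * (A * ‖X n ω‖ ^ (-ξ)) := by
    simpa [gainLE] using hn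
  have hgreat : IsGreatest (channelGains X h d₀ A ξ ω)
      (‖h n ω‖ ^ 2 * (A * ‖X n ω‖ ^ (-ξ))) := by
    refine ⟨⟨n, hn'.1, rfl⟩, ?_⟩
    rintro _ ⟨m, hm, rfl⟩
    by_cases hmk : ‖h m ω‖ ^ 2 * (A * ‖X m ω‖ ^ (-ξ)) ≤ 1 / ((k : ℝ) + 1)
    · exact hmk.trans hn'.2.le
    · exact (le_total _ _).elim id fun hle => hmax (fun H => hmk (H hm)) hle
  rw [strongestGain, hgreat.csSup_eq]
  exact hgreat

/-- The distribution function of the strongest gain. -/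
theorem measureReal_strongestGain_le (hX : IsHomogeneousPoissonOn P {x | d₀ ≤ ‖x‖} lam X)
    (hh : IsRayleighFading P X h) (hM : 1 ≤ M) (hlam : 0 < lam) (hd₀ : 0 < d₀) (hA : 0 < A)
    (hξ : 0 < ξ) {g : ℝ} (hg : 0 < g) :
    P.real {ω | strongestGain X h d₀ A ξ ω ≤ g} = outageFormula lam d₀ ξ M (g / A) := by
  have hae : {ω | strongestGain X h d₀ A ξ ω ≤ g} =ᵐ[P]
      {ω | ∀ n, (X n ω, ‖h n ω‖ ^ 2) ∈ gainLE d₀ A ξ g} := by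
    filter_upwards [ae_isGreatest_strongestGain hX hh hM hlam hd₀ hA hξ] with ω hω
    refine propext ?_
    change strongestGain X h d₀ A ξ ω ≤ g ↔ _
    rw [isLUB_le_iff hω.isLUB]
    exact forall_channelGains_le_iff
  rw [measureReal_def, measure_congr hae, measure_forall_gainLE hX hh hlam hd₀ hA hξ hg,
    ENNReal.toReal_ofReal]
  exact (Real.exp_pos _).le

end StrongestGain

/-! ### Outage events as bounds on the gain -/

lemma sensingPower_le_iff {G η Pp α₁ β T Ps : ℝ} (hη : 0 < η) (hPp : 0 < Pp) (hT : 0 < T)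
    (hα₁ : 0 < α₁) (hβ : 0 < β) :
    sensingPower G η Pp α₁ β T ≤ Ps ↔ G ≤ β * Ps / (η * Pp * α₁) := by
  have h2 : G * η * Pp * α₁ * T / (β * T) = G * (η * Pp * α₁) / β := by
    field_simp
  rw [sensingPower, harvestedEnergy, h2, div_le_iff₀ hβ, le_div_iff₀ (by positivity),
    mul_comm Ps]

lemma transmissionPower_le_iff {G η Pp α₁ β α₂ T Ps Pt : ℝ} (hη : 0 < η) (hPp : 0 < Pp)
    (hT : 0 < T) (hα₁ : 0 < α₁) (hα₂ : 0 ≤ α₂) (hsum : α₁ + β + α₂ < 1) :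
    transmissionPower G η Pp α₁ β α₂ T Ps ≤ Pt ↔
      G ≤ (Pt * (1 - α₁ - β - α₂) + Ps * β) / (η * Pp * (α₁ + α₂)) := by
  have h1 : 0 < 1 - α₁ - β - α₂ := by linarith
  have h2 : (G * η * Pp * α₁ * T - Ps * β * T + G * η * Pp * α₂ * T) /
      ((1 - α₁ - β - α₂) * T) =
      (G * (η * Pp * (α₁ + α₂)) - Ps * β) / (1 - α₁ - β - α₂) := by
    rw [← mul_div_mul_right (G * (η * Pp * (α₁ + α₂)) - Ps * β) _ hT.ne']
    congr 1
    ring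
  rw [transmissionPower, harvestedEnergy, harvestedEnergy, h2, div_le_iff₀ h1,
    le_div_iff₀ (by positivity), sub_le_iff_le_add]

end

theorem theorem1 {Ω : Type*} [MeasurableSpace Ω] (P : Measure Ω) [IsProbabilityMeasure P]
    (M : ℕ) (hM : 1 ≤ M)
    (lam d₀ A ξ η Pp T α₁ β α₂ Ps Pt : ℝ)
    (hlam : 0 < lam) (hd₀ : 0 < d₀) (hA : 0 < A) (hξ : 2 ≤ ξ) (hη : 0 < η) (hPp : 0 < Pp)
    (hT : 0 < T) (hα₁ : 0 < α₁) (hβ : 0 < β) (hα₂ : 0 ≤ α₂) (hsum : α₁ + β + α₂ < 1)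
    (hPs : 0 < Ps) (hPt : 0 < Pt)
    (X : ℕ → Ω → EuclideanSpace ℝ (Fin 2)) (h : ℕ → Ω → EuclideanSpace ℂ (Fin M))
    (hX : IsHomogeneousPoissonOn P {x | d₀ ≤ ‖x‖} lam X)
    (hh : IsRayleighFading P X h) :
    (∀ᵐ ω ∂P, IsGreatest (channelGains X h d₀ A ξ ω) (strongestGain X h d₀ A ξ ω)) ∧
    P.real {ω | sensingPower (strongestGain X h d₀ A ξ ω) η Pp α₁ β T ≤ Ps} =
      outageFormula lam d₀ ξ M (muSensing η Pp A α₁ β Ps) ∧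
    P.real {ω | transmissionPower (strongestGain X h d₀ A ξ ω) η Pp α₁ β α₂ T Ps ≤ Pt} =
      outageFormula lam d₀ ξ M (muTransmission η Pp A α₁ β α₂ Ps Pt) := by
  have hξ' : 0 < ξ := by linarith
  have h1 : 0 < 1 - α₁ - β - α₂ := by linarith
  refine ⟨ae_isGreatest_strongestGain hX hh hM hlam hd₀ hA hξ', ?_, ?_⟩
  · simp_rw [sensingPower_le_iff hη hPp hT hα₁ hβ]
    rw [measureReal_strongestGain_le hX hh hM hlam hd₀ hA hξ' (by positivity), muSensing, div_div]
    congr 2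
    ring
  · simp_rw [transmissionPower_le_iff hη hPp hT hα₁ hα₂ hsum]
    rw [measureReal_strongestGain_le hX hh hM hlam hd₀ hA hξ' (by positivity), muTransmission,
      div_div]
    congr 2
    ring
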